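/- Let $n,m\in\mathbb N$, let $D_X\in\mathbb R^{n\times n}$ and $D_Y\in\mathbb R^{m\times m}$ be symmetric matrices, and let $\mu\in\mathbb R^n$, $\nu\in\mathbb R^m$ be probability vectors (nonnegative entries summing to $1$). Equip $\mathbb R^{n\times m}$ with the Frobenius inner product and norm, and put $$f(\pi)=-\operatorname{Tr}(D_X\pi D_Y\pi^T),\qquad C_1=\{\pi\ge 0:\pi\mathbf 1_m=\mu\},\qquad C_2=\{\pi\ge 0:\pi^T\mathbf 1_n=\nu\}.$$ For a convex set $C$ and $x\in C$ let $\mathcal N_C(x)=\{v:\langle v,y-x\rangle\le 0\ \text{for all } y\in C\}$, and $\mathcal N_C(x)=\emptyset$ for $x\notin C$. The critical set of the Gromov–Wasserstein (GW) problem $\min_{\pi\in C_1\cap C_2}f(\pi)$ is $$\mathcal X=\{\pi\in C_1\cap C_2: 0\in\nabla f(\pi)+\mathcal N_{C_1}(\pi)+\mathcal N_{C_2}(\pi)\}.$$ Let $\sigma>0$. Then $\mathcal X\neq\emptyset$, and there are constants $\tau_1,\tau_2$, depending only on $D_X,D_Y,\mu,\nu,\sigma$, such that the following holds for every $\rho>0$,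 every open convex set $D\subseteq\mathbb R^{n\times m}$ and every function $h$ that is differentiable on $D$ and $\sigma$-strongly convex on $D\cap\operatorname{conv}(C_1\cup C_2)$ (for a Legendre kernel $h$, $D$ is the interior of its domain; for instance $D=\mathbb R^{n\times m}$ for $h(x)=\tfrac12\|x\|^2$ and $D=(0,\infty)^{n\times m}$ for $h(x)=\sum_{ij}x_{ij}\log x_{ij}$). Let $(\pi^\star,w^\star)\in D\times D$ be a fixed point of Bregman Alternating Projected Gradient (BAPG) with kernel $h$ and parameter $\rho$, that is, suppose there are $p\in\mathcal N_{C_1}(\pi^\star)$ and $q\in\mathcal N_{C_2}(w^\star)$ with $$\nabla f(w^\star)+\rho\,(\nabla h(\pi^\star)-\nabla h(w^\star))+p=0,\qquad \nabla f(\pi^\star)+\rho\,(\nabla h(w^\star)-\nabla h(\pi^\star))+q=0.$$ Then $$\|\pi^\star-w^\star\|\le\frac{\tau_1}{\rho}\qquad\text{and}\qquad \operatorname{dist}\!\left(\frac{\pi^\star+w^\star}{2},\mathcal X\right)\le\frac{\tau_2}{\rho}.$$ -/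

import Mathlib

noncomputable section

namespace GW

/-- The space `ℝ^{n × m}` with the Frobenius (Euclidean) norm and inner product. -/
abbrev Coupling (n m : ℕ) : Type := EuclideanSpace ℝ (Fin n × Fin m)

/-- The `n × m` matrix of entries of `π`. -/
def toMat {n m : ℕ} (π : Coupling n m) : Matrix (Fin n) (Fin m) ℝ :=
  Matrix.of fun i j => π (i, j)

/-- The Gromov–Wasserstein objective `f(π) = -Tr(D_X π D_Y πᵀ)`. -/
def objective {n m : ℕ} (DX : Matrix (Fin n) (Fin n) ℝ) (DY : Matrix (Fin m) (Fin m) ℝ)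
    (π : Coupling n m) : ℝ :=
  -(DX * toMat π * DY * (toMat π).transpose).trace

/-- `C₁ = {π ≥ 0 : π 1_m = μ}`. -/
def rowSet {n : ℕ} (m : ℕ) (μ : Fin n → ℝ) : Set (Coupling n m) :=
  {π | (∀ i j, 0 ≤ π (i, j)) ∧ ∀ i, ∑ j, π (i, j) = μ i}

/-- `C₂ = {π ≥ 0 : πᵀ 1_n = ν}`. -/
def colSet (n : ℕ) {m : ℕ} (ν : Fin m → ℝ) : Set (Coupling n m) :=
  {π | (∀ i j, 0 ≤ π (i, j)) ∧ ∀ j, ∑ i, π (i, j) = ν j}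

/-- The normal cone to a convex set `C` at `x` (empty when `x ∉ C`). -/
def normalCone {E : Type*} [NormedAddCommGroup E] [InnerProductSpace ℝ E]
    (C : Set E) (x : E) : Set E :=
  {v | x ∈ C ∧ ∀ y ∈ C, inner ℝ v (y - x) ≤ 0}

/-- The critical set `{π ∈ C₁ ∩ C₂ : 0 ∈ ∇f(π) + N_{C₁}(π) + N_{C₂}(π)}`. -/
def criticalSet {n m : ℕ} (DX : Matrix (Fin n) (Fin n) ℝ) (DY : Matrix (Fin m) (Fin m) ℝ)
    (μ : Fin n → ℝ) (ν : Fin m → ℝ) : Set (Coupling n m) :=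
  {π | π ∈ rowSet m μ ∩ colSet n ν ∧
    ∃ p ∈ normalCone (rowSet m μ) π, ∃ q ∈ normalCone (colSet n ν) π,
      gradient (objective DX DY) π + p + q = 0}

/-- The fixed-point set of BAPG with kernel `h` and parameter `ρ`. -/
def fixedPointSet {n m : ℕ} (DX : Matrix (Fin n) (Fin n) ℝ) (DY : Matrix (Fin m) (Fin m) ℝ)
    (μ : Fin n → ℝ) (ν : Fin m → ℝ) (h : Coupling n m → ℝ) (ρ : ℝ) :
    Set (Coupling n m × Coupling n m) :=
  {z | ∃ p ∈ normalCone (rowSet m μ) z.1, ∃ q ∈ normalCone (colSet n ν) z.2,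
    gradient (objective DX DY) z.2 + ρ • (gradient h z.1 - gradient h z.2) + p = 0 ∧
    gradient (objective DX DY) z.1 + ρ • (gradient h z.2 - gradient h z.1) + q = 0}

end GW

end

/-! A fixed point `(π, w)` satisfies `∇f(π) + ∇f(w) + p + q = 0` with `p ∈ N_{C₁}(π)` and
`q ∈ N_{C₂}(w)`. As `∇f` is linear, the midpoint of `π` and `w` therefore satisfies the KKT
conditions of the problem up to an error `O(‖π - w‖)` in feasibility and in complementarity. Fixing
the support of the multipliers turns the KKT conditions into a linear system, so Hoffman's error
bound, taken over the finitely many supports, provides a critical point within `O(‖π - w‖)`.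

To see that `‖π - w‖ = O(1 / ρ)`, test both fixed-point equations against some `z ∈ C₁ ∩ C₂` with
`‖π - z‖ = O(‖π - w‖)`, again given by Hoffman's bound: strong monotonicity of `∇h` yields
`ρ σ ‖π - w‖² ≤ ⟨∇f(w), z - π⟩ + ⟨∇f(π), z - w⟩ = O(‖π - w‖)`.
-/

namespace GW

open Filter Topology

section Hoffman

variable {E F ι : Type*} [NormedAddCommGroup E] [NormedSpace ℝ E]
  [NormedAddCommGroup F] [NormedSpace ℝ F]

/-- The polyhedron cut out by the linear inequalities `ℓ i x ≤ c i`. The solution set of a mixed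
system of inequalities and equations is written `polyhedron ℓ c ∩ B ⁻¹' {d}`. -/
def polyhedron (ℓ : ι → E →L[ℝ] ℝ) (c : ι → ℝ) : Set E :=
  {x | ∀ i, ℓ i x ≤ c i}

lemma isClosed_polyhedron (ℓ : ι → E →L[ℝ] ℝ) (c : ι → ℝ) : IsClosed (polyhedron ℓ c) := by
  simp only [polyhedron, Set.ofPred_forall]
  exact isClosed_iInter fun i => isClosed_le (ℓ i).continuous continuous_const

lemma convex_polyhedron (ℓ : ι → E →L[ℝ] ℝ) (c : ι → ℝ) : Convex ℝ (polyhedron ℓ c) := by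
  simp only [polyhedron, Set.ofPred_forall]
  exact convex_iInter fun i => convex_halfSpace_le (ℓ i).toLinearMap.isLinear _

lemma eventually_add_smul_mem_polyhedron [Finite ι] {ℓ : ι → E →L[ℝ] ℝ} {c : ι → ℝ} {x v : E}
    (hx : x ∈ polyhedron ℓ c) (hv : ∀ i, ℓ i x = c i → ℓ i v ≤ 0) :
    ∀ᶠ t : ℝ in 𝓝[>] 0, x + t • v ∈ polyhedron ℓ c := by
  refine eventually_all.2 fun i => ?_
  rcases (hx i).eq_or_lt with hactive | hinactive
  · filter_upwards [self_mem_nhdsWithin] with t ht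
    have := mul_nonpos_of_nonneg_of_nonpos (le_of_lt ht) (hv i hactive)
    simpa [hactive]
  · have hcont : Continuous fun t : ℝ => ℓ i (x + t • v) := by fun_prop
    have hlt : ∀ᶠ t in 𝓝 (0 : ℝ), ℓ i (x + t • v) < c i :=
      hcont.continuousAt.eventually_lt_const (by simpa)
    exact (hlt.filter_mono nhdsWithin_le_nhds).mono fun _ => le_of_lt

lemma exists_norm_le_mul_of_pos_homogeneous [ProperSpace E] {K : Set E} (hK : IsClosed K)
    (hKsmul : ∀ t : ℝ, 0 < t → ∀ x ∈ K, t • x ∈ K) {g : E → ℝ} (hg : Continuous g)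
    (hgsmul : ∀ t : ℝ, 0 < t → ∀ x, g (t • x) = t * g x) (hpos : ∀ x ∈ K, x ≠ 0 → 0 < g x) :
    ∃ κ : ℝ, 0 ≤ κ ∧ ∀ x ∈ K, ‖x‖ ≤ κ * g x := by
  have hpos' : ∀ u ∈ K ∩ Metric.sphere 0 1, 0 < g u := fun u hu =>
    hpos u hu.1 (Metric.ne_of_mem_sphere hu.2 one_ne_zero)
  obtain ⟨κ, hκ⟩ := ((isCompact_sphere (0 : E) 1).inter_left hK).exists_bound_of_continuousOn
    (hg.continuousOn.inv₀ fun u hu => (hpos' u hu).ne')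
  refine ⟨max κ 0, le_max_right _ _, fun x hx => ?_⟩
  rcases eq_or_ne x 0 with rfl | hx0
  · have hg0 : g 0 = 2 * g 0 := by simpa using hgsmul 2 two_pos 0
    rw [norm_zero, show g 0 = 0 by linarith, mul_zero]
  have hxn : 0 < ‖x‖ := norm_pos_iff.2 hx0
  set u := ‖x‖⁻¹ • x with hu
  have huK : u ∈ K ∩ Metric.sphere 0 1 :=
    ⟨hKsmul _ (inv_pos.2 hxn) x hx, by simp [hu, norm_smul, hx0]⟩
  have hgx : g x = ‖x‖ * g u := by rw [hu, hgsmul _ (inv_pos.2 hxn), mul_inv_cancel_left₀ hxn.ne']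
  have hgu := hpos' u huK
  calc ‖x‖ = (g u)⁻¹ * g x := by rw [hgx]; field_simp
    _ ≤ max κ 0 * g x := by
      gcongr
      · rw [hgx]; positivity
      · exact (le_abs_self _).trans ((hκ u huK).trans (le_max_left _ _))

variable [FiniteDimensional ℝ E] [Finite ι]

/-- The condition on `z` says that `0` is a nearest point to `z` in the cone
`{v | B v = 0 ∧ ∀ i ∈ I, ℓ i v ≤ 0}`. -/
lemma exists_norm_le_mul_of_isNearest_zero (ℓ : ι → E →L[ℝ] ℝ) (B : E →L[ℝ] F) (I : Set ι) :
    ∃ κ : ℝ, 0 ≤ κ ∧ ∀ (z : E) (r : ℝ),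
      (∀ v, (∀ i ∈ I, ℓ i v ≤ 0) → B v = 0 → ‖z‖ ≤ ‖z - v‖) →
      (∀ i ∈ I, ℓ i z ≤ r) → ‖B z‖ ≤ r → ‖z‖ ≤ κ * r := by
  have := Fintype.ofFinite I
  let K : Set E := {z | ∀ v, (∀ i ∈ I, ℓ i v ≤ 0) → B v = 0 → ‖z‖ ≤ ‖z - v‖}
  let residual : E → (I → ℝ) × F := fun z => (fun i => max (ℓ i z) 0, B z)
  have hK : IsClosed K := by
    simp only [K, Set.ofPred_forall]
    exact isClosed_iInter fun v => isClosed_iInter fun _ => isClosed_iInter fun _ =>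
      isClosed_le (by fun_prop) (by fun_prop)
  have hKsmul : ∀ t : ℝ, 0 < t → ∀ z ∈ K, t • z ∈ K := fun t ht z hz v hv hBv => by
    have h := hz (t⁻¹ • v)
      (fun i hi => by simpa using mul_nonpos_of_nonneg_of_nonpos (inv_nonneg.2 ht.le) (hv i hi))
      (by simp [hBv])
    calc ‖t • z‖ = t * ‖z‖ := norm_smul_of_nonneg ht.le z
      _ ≤ t * ‖z - t⁻¹ • v‖ := by gcongr
      _ = ‖t • z - v‖ := by
        rw [← norm_smul_of_nonneg ht.le, smul_sub, smul_inv_smul₀ ht.ne']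
  have hsmul : ∀ t : ℝ, 0 < t → ∀ z, ‖residual (t • z)‖ = t * ‖residual z‖ := fun t ht z => by
    rw [← norm_smul_of_nonneg ht.le]
    congr 1
    ext i
    · simp [residual, mul_max_of_nonneg _ _ ht.le]
    · simp [residual]
  have hpos : ∀ z ∈ K, z ≠ 0 → 0 < ‖residual z‖ := fun z hz hz0 => by
    refine norm_pos_iff.2 fun h => hz0 ?_
    have hle : ∀ i ∈ I, ℓ i z ≤ 0 := fun i hi =>
      max_eq_right_iff.1 (congrFun (congrArg Prod.fst h) ⟨i, hi⟩)
    simpa using hz z hle (congrArg Prod.snd h)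
  obtain ⟨κ, hκ0, hκ⟩ := exists_norm_le_mul_of_pos_homogeneous hK hKsmul
    (g := fun z => ‖residual z‖) (by fun_prop) hsmul hpos
  refine ⟨κ, hκ0, fun z r hz hℓ hB => (hκ z hz).trans (mul_le_mul_of_nonneg_left ?_ hκ0)⟩
  have hr : 0 ≤ r := (norm_nonneg _).trans hB
  refine norm_prod_le_iff.2 ⟨(pi_norm_le_iff_of_nonneg hr).2 fun i => ?_, hB⟩
  rw [Real.norm_of_nonneg (le_max_right _ _)]
  exact max_le (hℓ i i.2) hr

/-- **Hoffman's error bound** -/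
theorem exists_mem_polyhedron_norm_sub_le (ℓ : ι → E →L[ℝ] ℝ) (B : E →L[ℝ] F) :
    ∃ κ : ℝ, 0 ≤ κ ∧ ∀ (c : ι → ℝ) (d : F), (polyhedron ℓ c ∩ B ⁻¹' {d}).Nonempty →
      ∀ (z : E) (r : ℝ), (∀ i, ℓ i z ≤ c i + r) → ‖B z - d‖ ≤ r →
        ∃ y ∈ polyhedron ℓ c ∩ B ⁻¹' {d}, ‖z - y‖ ≤ κ * r := by
  have := Fintype.ofFinite (Set ι)
  choose κ hκ0 hκ using exists_norm_le_mul_of_isNearest_zero ℓ B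
  refine ⟨∑ I, κ I, Finset.sum_nonneg fun I _ => hκ0 I, fun c d hne z r hz hBz => ?_⟩
  have hclosed : IsClosed (polyhedron ℓ c ∩ B ⁻¹' {d}) :=
    (isClosed_polyhedron ℓ c).inter (isClosed_singleton.preimage B.continuous)
  obtain ⟨y, hy, hdist⟩ := hclosed.exists_infDist_eq_dist hne z
  have hBy : B y = d := hy.2
  have hnearest : ∀ v, (∀ i ∈ {i | ℓ i y = c i}, ℓ i v ≤ 0) → B v = 0 →
      ‖z - y‖ ≤ ‖z - y - v‖ := by
    intro v hv hBv
    obtain ⟨t, ⟨ht, ht1⟩, ht0⟩ := ((eventually_add_smul_mem_polyhedron hy.1 hv).and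
      (nhdsWithin_le_nhds (eventually_le_nhds one_pos)) |>.and self_mem_nhdsWithin).exists
    have ht0 : 0 < t := ht0
    have hmem : y + t • v ∈ polyhedron ℓ c ∩ B ⁻¹' {d} := ⟨ht, by simp [hBv, hBy]⟩
    have hle : ‖z - y‖ ≤ ‖z - (y + t • v)‖ := by
      simpa only [← dist_eq_norm, ← hdist] using Metric.infDist_le_dist_of_mem hmem
    have hconvex : ‖z - (y + t • v)‖ ≤ (1 - t) * ‖z - y‖ + t * ‖z - y - v‖ :=
      calc ‖z - (y + t • v)‖ = ‖(1 - t) • (z - y) + t • (z - y - v)‖ := by congr 1; module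
        _ ≤ _ := by
          refine (norm_add_le _ _).trans_eq ?_
          rw [norm_smul_of_nonneg (sub_nonneg.2 ht1), norm_smul_of_nonneg ht0.le]
    exact le_of_mul_le_mul_left (by linarith) ht0
  have hr : 0 ≤ r := (norm_nonneg _).trans hBz
  have hyz := hκ {i | ℓ i y = c i} (z - y) r hnearest
    (fun i hi => by rw [map_sub, show ℓ i y = c i from hi]; linarith [hz i])
    (by rwa [map_sub, hBy])
  exact ⟨y, hy, hyz.trans <| mul_le_mul_of_nonneg_right
    (Finset.single_le_sum (fun I _ => hκ0 I) (Finset.mem_univ _)) hr⟩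

lemma isClosed_setOf_nonempty_polyhedron (ℓ : ι → E →L[ℝ] ℝ) (B : E →L[ℝ] F) :
    IsClosed {u : (ι → ℝ) × F | (polyhedron ℓ u.1 ∩ B ⁻¹' {u.2}).Nonempty} := by
  have := Fintype.ofFinite ι
  obtain ⟨κ, -, hκ⟩ := exists_mem_polyhedron_norm_sub_le ℓ B
  refine IsSeqClosed.isClosed fun u u₀ hu hlim => ?_
  obtain ⟨z, hz, hBz⟩ := hu 0
  have hsol : ∀ j, ∃ y ∈ polyhedron ℓ (u j).1 ∩ B ⁻¹' {(u j).2}, ‖z - y‖ ≤ κ * ‖u 0 - u j‖ := by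
    refine fun j => hκ _ _ (hu j) z _ (fun i => ?_) ?_
    · have hi : (u 0).1 i - (u j).1 i ≤ ‖u 0 - u j‖ := (Real.le_norm_self _).trans <|
        (norm_le_pi_norm (u 0 - u j).1 i).trans (norm_fst_le (u 0 - u j))
      linarith [hz i]
    · rw [show B z = (u 0).2 from hBz]
      exact norm_snd_le (u 0 - u j)
  choose y hy hyz using hsol
  obtain ⟨R, hR⟩ := (Metric.isBounded_range_of_tendsto _
    ((hlim.const_sub (u 0)).norm.const_mul κ)).exists_norm_le
  obtain ⟨x, -, φ, hφ, hx⟩ := (isCompact_closedBall z R).tendsto_subseq (x := y) fun j => by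
    rw [Metric.mem_closedBall, dist_comm, dist_eq_norm]
    exact (hyz j).trans ((le_abs_self _).trans (hR _ ⟨j, rfl⟩))
  have hu_lim := hlim.comp hφ.tendsto_atTop
  refine ⟨x, fun i => ?_, ?_⟩
  · exact le_of_tendsto_of_tendsto' (((ℓ i).continuous.tendsto x).comp hx)
      (((continuous_apply i).comp continuous_fst).tendsto u₀ |>.comp hu_lim) fun j => (hy _).1 i
  · exact tendsto_nhds_unique ((B.continuous.tendsto x).comp hx)
      (((continuous_snd.tendsto u₀).comp hu_lim).congr fun j => ((hy (φ j)).2).symm)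

/-- The condition `C * r < 1` takes care of infeasible systems, whose residuals are bounded
away from `0`. -/
theorem eventually_exists_mem_polyhedron_norm_sub_le (ℓ : ι → E →L[ℝ] ℝ) (B : E →L[ℝ] F)
    (c : ι → ℝ) (d : F) :
    ∀ᶠ C : ℝ in atTop, ∀ (z : E) (r : ℝ), (∀ i, ℓ i z ≤ c i + r) → ‖B z - d‖ ≤ r → C * r < 1 →
      ∃ y ∈ polyhedron ℓ c ∩ B ⁻¹' {d}, ‖z - y‖ ≤ C * r := by
  have := Fintype.ofFinite ι
  by_cases hne : (polyhedron ℓ c ∩ B ⁻¹' {d}).Nonempty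
  · obtain ⟨κ, -, hκ⟩ := exists_mem_polyhedron_norm_sub_le ℓ B
    filter_upwards [eventually_ge_atTop κ] with C hC z r hz hBz _
    obtain ⟨y, hy, hyz⟩ := hκ c d hne z r hz hBz
    exact ⟨y, hy, hyz.trans (mul_le_mul_of_nonneg_right hC ((norm_nonneg _).trans hBz))⟩
  · obtain ⟨ε, hε, hball⟩ := Metric.isOpen_iff.1
      (isClosed_setOf_nonempty_polyhedron ℓ B).isOpen_compl (c, d) hne
    filter_upwards [eventually_ge_atTop ε⁻¹] with C hC z r hz hBz hCr
    have hr : 0 ≤ r := (norm_nonneg _).trans hBz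
    have hrε : r < ε := (inv_mul_lt_one₀ hε).1 ((mul_le_mul_of_nonneg_right hC hr).trans_lt hCr)
    have hnear : ((fun i => c i + r, B z) : (ι → ℝ) × F) ∈ Metric.ball (c, d) ε := by
      rw [Metric.mem_ball, dist_eq_norm]
      refine lt_of_le_of_lt (norm_prod_le_iff.2 ⟨?_, hBz⟩) hrε
      exact (pi_norm_le_iff_of_nonneg hr).2 fun i => by simp [abs_of_nonneg hr]
    exact absurd ⟨z, hz, rfl⟩ (hball hnear)

end Hoffman

section NormalCone

open scoped RealInnerProductSpace

variable {E ι κ : Type*} [NormedAddCommGroup E] [InnerProductSpace ℝ E]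

lemma sum_smul_mem_normalCone [Fintype ι] {C : Set E} {x : E} (hx : x ∈ C) {η : ι → ℝ} {b : ι → E}
    (hη : ∀ i, 0 ≤ η i) (hb : ∀ i, η i ≠ 0 → b i ∈ normalCone C x) :
    ∑ i, η i • b i ∈ normalCone C x := by
  refine ⟨hx, fun y hy => ?_⟩
  simp only [sum_inner, real_inner_smul_left]
  refine Finset.sum_nonpos fun i _ => ?_
  rcases eq_or_ne (η i) 0 with h0 | h0
  · rw [h0, zero_mul]
  · exact mul_nonpos_of_nonneg_of_nonpos (hη i) ((hb i h0).2 y hy)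

lemma smul_mem_normalCone {C : Set E} {x v : E} {t : ℝ} (ht : 0 ≤ t) (hv : v ∈ normalCone C x) :
    t • v ∈ normalCone C x := by
  refine ⟨hv.1, fun y hy => ?_⟩
  rw [real_inner_smul_left]
  exact mul_nonpos_of_nonneg_of_nonpos ht (hv.2 y hy)

lemma mem_normalCone_polyhedron_of_inner_eq {a : ι → E} {c : ι → ℝ} {x : E} {i : ι}
    (hx : x ∈ polyhedron (fun i => innerSL ℝ (a i)) c) (hi : ⟪a i, x⟫ = c i) :
    a i ∈ normalCone (polyhedron (fun i => innerSL ℝ (a i)) c) x := by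
  refine ⟨hx, fun y hy => ?_⟩
  rw [inner_sub_right, hi, sub_nonpos]
  exact hy i

lemma mem_hull_range_iff [Fintype ι] {a : ι → E} {p : E} :
    p ∈ PointedCone.hull ℝ (Set.range a) ↔ ∃ η : ι → ℝ, (∀ i, 0 ≤ η i) ∧ ∑ i, η i • a i = p := by
  rw [PointedCone.hull, Submodule.mem_span_range_iff_exists_fun]
  exact ⟨fun ⟨η, h⟩ => ⟨fun i => η i, fun i => (η i).2, h⟩,
    fun ⟨η, hη, h⟩ => ⟨fun i => ⟨η i, hη i⟩, h⟩⟩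

lemma isClosed_hull_range [Finite ι] (a : ι → E) :
    IsClosed (PointedCone.hull ℝ (Set.range a) : Set E) := by
  have := Fintype.ofFinite ι
  let ℓ : ι → (ι → ℝ) →L[ℝ] ℝ := fun i => -ContinuousLinearMap.proj i
  let B : (ι → ℝ) →L[ℝ] E := ∑ i, (ContinuousLinearMap.proj i).smulRight (a i)
  convert (isClosed_setOf_nonempty_polyhedron ℓ B).preimage (.prodMk_right (0 : ι → ℝ)) using 1
  ext p
  simp [mem_hull_range_iff, Set.Nonempty, polyhedron, ℓ, B]

/-- **Farkas' lemma** -/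
theorem exists_nonneg_sum_smul_eq [Fintype ι] [CompleteSpace E] {a : ι → E} {p : E}
    (hp : ∀ v, (∀ i, ⟪a i, v⟫ ≤ 0) → ⟪p, v⟫ ≤ 0) :
    ∃ η : ι → ℝ, (∀ i, 0 ≤ η i) ∧ ∑ i, η i • a i = p := by
  rw [← mem_hull_range_iff]
  by_contra hmem
  let K : ProperCone ℝ E := ⟨PointedCone.hull ℝ (Set.range a), isClosed_hull_range a⟩
  obtain ⟨v, hv, hpv⟩ := K.hyperplane_separation' hmem
  have hav : ∀ i, ⟪a i, -v⟫ ≤ 0 := fun i => by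
    simpa using hv (a i) (PointedCone.subset_hull ⟨i, rfl⟩)
  have := hp (-v) hav
  rw [inner_neg_right] at this
  linarith

lemma exists_multiplier_of_mem_normalCone_polyhedron [Fintype ι] [CompleteSpace E]
    {a : ι → E} {c : ι → ℝ} {x p : E}
    (hp : p ∈ normalCone (polyhedron (fun i => innerSL ℝ (a i)) c) x) :
    ∃ η : ι → ℝ, (∀ i, 0 ≤ η i) ∧ (∀ i, η i ≠ 0 → ⟪a i, x⟫ = c i) ∧ ∑ i, η i • a i = p := by
  let active : Set ι := {i | ⟪a i, x⟫ = c i}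
  have hfarkas : ∀ v, (∀ i, ⟪active.indicator a i, v⟫ ≤ 0) → ⟪p, v⟫ ≤ 0 := fun v hv => by
    have hfeasible : ∀ i, ⟪a i, x⟫ = c i → ⟪a i, v⟫ ≤ 0 := fun i hi => by
      simpa only [Set.indicator_of_mem (show i ∈ active from hi)] using hv i
    obtain ⟨t, hmem, ht⟩ :=
      ((eventually_add_smul_mem_polyhedron hp.1 hfeasible).and self_mem_nhdsWithin).exists
    have := hp.2 _ hmem
    rw [add_sub_cancel_left, real_inner_smul_right] at this
    exact nonpos_of_mul_nonpos_right this ht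
  obtain ⟨η, hη, hsum⟩ := exists_nonneg_sum_smul_eq hfarkas
  refine ⟨active.indicator η, fun i => Set.indicator_nonneg (fun i _ => hη i) i,
    fun i hi => show i ∈ active from Set.mem_of_indicator_ne_zero hi, ?_⟩
  rw [← hsum]
  refine Finset.sum_congr rfl fun i _ => ?_
  by_cases hi : i ∈ active <;> simp [hi]

lemma abs_inner_le_pi_norm_mul_norm [Fintype ι] (a : ι → E) (v : E) (i : ι) :
    |⟪a i, v⟫| ≤ ‖a‖ * ‖v‖ :=
  (abs_real_inner_le_norm _ _).trans <|
    mul_le_mul_of_nonneg_right (norm_le_pi_norm a i) (norm_nonneg v)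

/-- A convex polyhedron: finitely many inequalities, written with inner products so that the vectors
`a i` generate the normal cones. -/
def IsPolyhedron (C : Set E) : Prop :=
  ∃ (ι : Type) (_ : Fintype ι) (a : ι → E) (c : ι → ℝ),
    C = polyhedron (fun i => innerSL ℝ (a i)) c

lemma polyhedron_inner_inter_polyhedron_inner (a : ι → E) (b : κ → E) (c : ι → ℝ) (d : κ → ℝ) :
    polyhedron (fun i => innerSL ℝ (a i)) c ∩ polyhedron (fun k => innerSL ℝ (b k)) d =
      polyhedron (fun j => innerSL ℝ (Sum.elim a b j)) (Sum.elim c d) := by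
  ext x
  simp only [polyhedron, Set.mem_inter_iff, Set.mem_ofPred_eq, Sum.forall, Sum.elim_inl,
    Sum.elim_inr]

namespace IsPolyhedron

variable {C C₁ C₂ : Set E}

lemma isClosed (hC : IsPolyhedron C) : IsClosed C := by
  obtain ⟨ι, _, a, c, rfl⟩ := hC
  exact isClosed_polyhedron _ _

lemma convex (hC : IsPolyhedron C) : Convex ℝ C := by
  obtain ⟨ι, _, a, c, rfl⟩ := hC
  exact convex_polyhedron _ _

lemma inter (hC₁ : IsPolyhedron C₁) (hC₂ : IsPolyhedron C₂) : IsPolyhedron (C₁ ∩ C₂) := by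
  obtain ⟨ι, _, a, c, rfl⟩ := hC₁
  obtain ⟨κ, _, b, d, rfl⟩ := hC₂
  exact ⟨ι ⊕ κ, inferInstance, _, _, polyhedron_inner_inter_polyhedron_inner a b c d⟩

lemma iInter {κ : Type} [Finite κ] {C : κ → Set E} (hC : ∀ k, IsPolyhedron (C k)) :
    IsPolyhedron (⋂ k, C k) := by
  have := Fintype.ofFinite κ
  choose ι _ a c hC using hC
  refine ⟨Σ k, ι k, inferInstance, fun i => a i.1 i.2, fun i => c i.1 i.2, ?_⟩
  ext x
  simp only [hC, polyhedron, Set.mem_iInter, Set.mem_ofPred_eq, Sigma.forall]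

lemma setOf_le [CompleteSpace E] (ℓ : E →L[ℝ] ℝ) (c : ℝ) : IsPolyhedron {x | ℓ x ≤ c} :=
  ⟨Unit, inferInstance, fun _ => (InnerProductSpace.toDual ℝ E).symm ℓ, fun _ => c, by
    simp [polyhedron]⟩

lemma setOf_eq [CompleteSpace E] (ℓ : E →L[ℝ] ℝ) (c : ℝ) : IsPolyhedron {x | ℓ x = c} := by
  convert (setOf_le ℓ c).inter (setOf_le (-ℓ) (-c)) using 1
  ext x
  simp [le_antisymm_iff]

lemma exists_add_eq_of_mem_normalCone_inter [CompleteSpace E] (hC₁ : IsPolyhedron C₁)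
    (hC₂ : IsPolyhedron C₂) {x v : E} (hv : v ∈ normalCone (C₁ ∩ C₂) x) :
    ∃ p ∈ normalCone C₁ x, ∃ q ∈ normalCone C₂ x, p + q = v := by
  obtain ⟨ι, _, a, c, rfl⟩ := hC₁
  obtain ⟨κ, _, b, d, rfl⟩ := hC₂
  have hx := hv.1
  rw [polyhedron_inner_inter_polyhedron_inner] at hv
  obtain ⟨η, hη, hactive, hsum⟩ := exists_multiplier_of_mem_normalCone_polyhedron hv
  rw [Fintype.sum_sum_type] at hsum
  exact ⟨_, sum_smul_mem_normalCone hx.1 (fun i => hη (.inl i))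
      fun i hi => mem_normalCone_polyhedron_of_inner_eq hx.1 (hactive (.inl i) hi),
    _, sum_smul_mem_normalCone hx.2 (fun k => hη (.inr k))
      fun k hk => mem_normalCone_polyhedron_of_inner_eq hx.2 (hactive (.inr k) hk), hsum⟩

lemma exists_mem_inter_norm_sub_le [FiniteDimensional ℝ E] (hC₁ : IsPolyhedron C₁)
    (hC₂ : IsPolyhedron C₂) (hne : (C₁ ∩ C₂).Nonempty) :
    ∃ κ : ℝ, 0 ≤ κ ∧ ∀ x ∈ C₁, ∀ y ∈ C₂, ∃ z ∈ C₁ ∩ C₂, ‖x - z‖ ≤ κ * ‖x - y‖ := by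
  obtain ⟨ι, _, a, c, rfl⟩ := hC₁
  obtain ⟨κ, _, b, d, rfl⟩ := hC₂
  rw [polyhedron_inner_inter_polyhedron_inner] at hne ⊢
  obtain ⟨κ, hκ, hoffman⟩ := exists_mem_polyhedron_norm_sub_le
    (fun j => innerSL ℝ (Sum.elim a b j)) (0 : E →L[ℝ] ℝ)
  refine ⟨κ * ‖b‖, by positivity, fun x hx y hy => ?_⟩
  have hb : ∀ k, ⟪b k, x⟫ ≤ d k + ‖b‖ * ‖x - y‖ := fun k => by
    have hxy := le_of_abs_le (abs_inner_le_pi_norm_mul_norm b (x - y) k)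
    have hyk : ⟪b k, y⟫ ≤ d k := hy k
    rw [inner_sub_right] at hxy
    linarith
  obtain ⟨z, hz, hxz⟩ := hoffman (Sum.elim c d) 0 ⟨hne.some, hne.some_mem, rfl⟩ x (‖b‖ * ‖x - y‖)
    (Sum.rec (fun i => (hx i).trans (le_add_of_nonneg_right (by positivity))) hb)
    (by simpa using by positivity)
  exact ⟨z, hz.1, by rwa [mul_assoc]⟩

end IsPolyhedron

end NormalCone

section KKT

open scoped RealInnerProductSpace

variable {E ι : Type*} [NormedAddCommGroup E] [InnerProductSpace ℝ E] [FiniteDimensional ℝ E]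
  [Fintype ι]

lemma eventually_exists_complementary_norm_sub_le (L : E →L[ℝ] E) (g : E) (a b : ι → E)
    (c : ι → ℝ) (I : Set ι) :
    ∀ᶠ C : ℝ in atTop, ∀ (z : E) (η : ι → ℝ) (r : ℝ),
      (∀ i, 0 ≤ η i) → L z + g + ∑ i, η i • b i = 0 → (∀ i, ⟪a i, z⟫ ≤ c i + r) →
      (∀ i ∈ I, c i - r ≤ ⟪a i, z⟫) → 0 ≤ r → C * r < 1 →
        ∃ y ∈ polyhedron (fun i => innerSL ℝ (a i)) c, ∃ θ : ι → ℝ,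
          (∀ i ∈ I, ⟪a i, y⟫ = c i) ∧ (∀ i, 0 ≤ θ i) ∧ L y + g + ∑ i, θ i • b i = 0 ∧
            ‖z - y‖ ≤ C * r := by
  let point := ContinuousLinearMap.fst ℝ E (ι → ℝ)
  let multiplier : ι → E × (ι → ℝ) →L[ℝ] ℝ :=
    fun i => (ContinuousLinearMap.proj i).comp (.snd ℝ E (ι → ℝ))
  let ℓ : ι ⊕ I ⊕ ι → E × (ι → ℝ) →L[ℝ] ℝ :=
    Sum.elim (fun i => (innerSL ℝ (a i)).comp point)
      (Sum.elim (fun i => -(innerSL ℝ (a i)).comp point) fun i => -multiplier i)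
  let rhs : ι ⊕ I ⊕ ι → ℝ := Sum.elim c (Sum.elim (fun i => -c i) 0)
  let B : E × (ι → ℝ) →L[ℝ] E := L.comp point + ∑ i, (multiplier i).smulRight (b i)
  have hB : ∀ u, B u = L u.1 + ∑ i, u.2 i • b i := fun u => by simp [B, point, multiplier]
  filter_upwards [eventually_exists_mem_polyhedron_norm_sub_le ℓ B rhs (-g)] with
    C hC z η r hη hstationary hfeasible hactive hr hCr
  have hresidual : B (z, η) - -g = 0 := by rw [hB, sub_neg_eq_add, add_right_comm, hstationary]
  obtain ⟨⟨y, θ⟩, ⟨hsol, hBy⟩, hdist⟩ := hC (z, η) r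
    (Sum.rec hfeasible (Sum.rec
      (fun i => by simpa [ℓ, rhs, point] using by linarith [hactive i i.2])
      fun i => by simpa [ℓ, rhs, multiplier] using by linarith [hη i]))
    (by rwa [hresidual, norm_zero]) hCr
  refine ⟨y, fun i => hsol (.inl i), θ, fun i hi => le_antisymm (hsol (.inl i)) ?_,
    fun i => ?_, ?_, (norm_fst_le ((z, η) - (y, θ))).trans hdist⟩
  · simpa [ℓ, rhs, point] using hsol (.inr (.inl ⟨i, hi⟩))
  · simpa [ℓ, rhs, multiplier] using hsol (.inr (.inr i))
  · rw [add_right_comm, ← hB (y, θ), show B (y, θ) = -g from hBy, neg_add_cancel]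

/-- **KKT error bound** for the affine variational inequality `0 ∈ L y + g + N_P(y)`. -/
theorem eventually_exists_neg_mem_normalCone_norm_sub_le (L : E →L[ℝ] E) (g : E) (a : ι → E)
    (c : ι → ℝ) :
    ∀ᶠ C : ℝ in atTop, ∀ (z : E) (η : ι → ℝ) (r : ℝ),
      (∀ i, 0 ≤ η i) → L z + g + ∑ i, η i • a i = 0 → (∀ i, ⟪a i, z⟫ ≤ c i + r) →
      (∀ i, η i ≠ 0 → c i - r ≤ ⟪a i, z⟫) → 0 ≤ r → C * r < 1 →
        ∃ y, -(L y + g) ∈ normalCone (polyhedron (fun i => innerSL ℝ (a i)) c) y ∧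
          ‖z - y‖ ≤ C * r := by
  -- Once the support `I` of the multiplier is fixed, the KKT conditions form a linear system.
  filter_upwards [eventually_all.2 fun I : Set ι =>
    eventually_exists_complementary_norm_sub_le L g a (I.indicator a) c I]
    with C hC z η r hη hstationary hfeasible hactive hr hCr
  have hsupport : ∑ i, η i • (Function.support η).indicator a i = ∑ i, η i • a i :=
    Finset.sum_congr rfl fun i _ => by by_cases hi : η i = 0 <;> simp [hi]
  obtain ⟨y, hy, θ, hyactive, hθ, hystationary, hdist⟩ :=
    hC (Function.support η) z η r hη (by rwa [hsupport]) hfeasible hactive hr hCr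
  refine ⟨y, ?_, hdist⟩
  rw [neg_eq_of_add_eq_zero_right hystationary]
  refine sum_smul_mem_normalCone hy hθ fun i _ => ?_
  by_cases hi : i ∈ Function.support η
  · rw [Set.indicator_of_mem hi]
    exact mem_normalCone_polyhedron_of_inner_eq hy (hyactive i hi)
  · rw [Set.indicator_of_notMem hi]
    exact ⟨hy, fun _ _ => (inner_zero_left _).le⟩

end KKT

section Polyhedral

open scoped RealInnerProductSpace

variable {E : Type*} [NormedAddCommGroup E] [InnerProductSpace ℝ E] [FiniteDimensional ℝ E]

lemma IsPolyhedron.exists_neg_mem_normalCone_inter_norm_sub_le {C₁ C₂ : Set E}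
    (hC₁ : IsPolyhedron C₁) (hC₂ : IsPolyhedron C₂) (L : E →L[ℝ] E) (g : E) :
    ∃ C : ℝ, 0 ≤ C ∧ ∀ (x y z : E) (r : ℝ), ∀ p ∈ normalCone C₁ x, ∀ q ∈ normalCone C₂ y,
      L z + g + (p + q) = 0 → ‖z - x‖ ≤ r → ‖z - y‖ ≤ r → C * r < 1 →
        ∃ u, -(L u + g) ∈ normalCone (C₁ ∩ C₂) u ∧ ‖z - u‖ ≤ C * r := by
  obtain ⟨ι, _, a, c, rfl⟩ := hC₁
  obtain ⟨κ, _, b, d, rfl⟩ := hC₂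
  rw [polyhedron_inner_inter_polyhedron_inner]
  obtain ⟨C, hC, hC0⟩ := ((eventually_exists_neg_mem_normalCone_norm_sub_le L g (Sum.elim a b)
    (Sum.elim c d)).and (eventually_ge_atTop 0)).exists
  refine ⟨C * ‖Sum.elim a b‖, by positivity, fun x y z r p hp q hq hsum hzx hzy hCr => ?_⟩
  obtain ⟨η, hη, hηx, rfl⟩ := exists_multiplier_of_mem_normalCone_polyhedron hp
  obtain ⟨θ, hθ, hθy, rfl⟩ := exists_multiplier_of_mem_normalCone_polyhedron hq
  have hnear : ∀ j {v}, ‖z - v‖ ≤ r →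
      |⟪Sum.elim a b j, z⟫ - ⟪Sum.elim a b j, v⟫| ≤ ‖Sum.elim a b‖ * r := fun j v hv => by
    rw [← inner_sub_right]
    exact (abs_inner_le_pi_norm_mul_norm _ _ j).trans (by gcongr)
  have hx := fun i => abs_le.1 (hnear (.inl i) hzx)
  have hy := fun k => abs_le.1 (hnear (.inr k) hzy)
  simp only [Sum.elim_inl, Sum.elim_inr] at hx hy
  have hxc : ∀ i, ⟪a i, x⟫ ≤ c i := hp.1
  have hyd : ∀ k, ⟪b k, y⟫ ≤ d k := hq.1
  rw [mul_assoc] at hCr ⊢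
  exact hC z (Sum.elim η θ) _ (Sum.rec hη hθ) (by simpa using hsum)
    (Sum.rec (fun i => by simpa using by linarith [hxc i, (hx i).2])
      fun k => by simpa using by linarith [hyd k, (hy k).2])
    (Sum.rec (fun i hi => by simpa using by linarith [hηx i hi, (hx i).1])
      fun k hk => by simpa using by linarith [hθy k hk, (hy k).1])
    (mul_nonneg (norm_nonneg _) ((norm_nonneg _).trans hzx)) hCr

end Polyhedral

section Stationary

open scoped RealInnerProductSpace

variable {E : Type*} [NormedAddCommGroup E] [InnerProductSpace ℝ E] [CompleteSpace E]

/-- The stationary points of `f` on `C₁ ∩ C₂`, the normal cones of `C₁` and `C₂` being taken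
separately; `GW.criticalSet` is the instance for the Gromov–Wasserstein problem. -/
def stationarySet (C₁ C₂ : Set E) (f : E → ℝ) : Set E :=
  {x | x ∈ C₁ ∩ C₂ ∧ ∃ p ∈ normalCone C₁ x, ∃ q ∈ normalCone C₂ x, gradient f x + p + q = 0}

/-- The fixed points of Bregman alternating projected gradient for `f` on `C₁ ∩ C₂`, with kernel
`h` and parameter `ρ`; `GW.fixedPointSet` is the instance for the Gromov–Wasserstein problem. -/
def bregmanFixedPointSet (C₁ C₂ : Set E) (f h : E → ℝ) (ρ : ℝ) : Set (E × E) :=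
  {z | ∃ p ∈ normalCone C₁ z.1, ∃ q ∈ normalCone C₂ z.2,
    gradient f z.2 + ρ • (gradient h z.1 - gradient h z.2) + p = 0 ∧
    gradient f z.1 + ρ • (gradient h z.2 - gradient h z.1) + q = 0}

lemma mem_stationarySet_of_neg_gradient_mem_normalCone {C₁ C₂ : Set E} {f : E → ℝ}
    (hC₁ : IsPolyhedron C₁) (hC₂ : IsPolyhedron C₂) {x : E}
    (hx : -gradient f x ∈ normalCone (C₁ ∩ C₂) x) :
    x ∈ stationarySet C₁ C₂ f := by
  obtain ⟨p, hp, q, hq, hpq⟩ := hC₁.exists_add_eq_of_mem_normalCone_inter hC₂ hx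
  exact ⟨hx.1, p, hp, q, hq, by rw [add_assoc, hpq, add_neg_cancel]⟩

lemma neg_gradient_mem_normalCone {C : Set E} (hC : Convex ℝ C) {f : E → ℝ} {x g : E} (hx : x ∈ C)
    (hmin : IsMinOn f C x) (hg : HasGradientAt f g x) : -g ∈ normalCone C x := by
  refine ⟨hx, fun y hy => ?_⟩
  have h := hmin.localize.hasFDerivWithinAt_nonneg hg.hasFDerivAt.hasFDerivWithinAt
    (sub_mem_posTangentConeAt_of_segment_subset (hC.segment_subset hx hy))
  simpa using h

lemma inner_gradient_sub_nonneg {s : Set E} {f : E → ℝ} (hf : ConvexOn ℝ s f) {x y a b : E}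
    (hx : x ∈ s) (hy : y ∈ s) (ha : HasGradientAt f a x) (hb : HasGradientAt f b y) :
    0 ≤ ⟪a - b, x - y⟫ := by
  have hderiv : ∀ {t : ℝ} {g : E}, HasGradientAt f g (AffineMap.lineMap y x t) →
      HasDerivAt (f ∘ AffineMap.lineMap y x) ⟪g, x - y⟫ t := fun hg => by
    simpa using hg.hasFDerivAt.comp_hasDerivAt _ AffineMap.hasDerivAt_lineMap
  have hline := hf.comp_affineMap (AffineMap.lineMap y x : ℝ →ᵃ[ℝ] E)
  have h0 : (0 : ℝ) ∈ AffineMap.lineMap y x ⁻¹' s := by simpa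
  have h1 : (1 : ℝ) ∈ AffineMap.lineMap y x ⁻¹' s := by simpa
  rw [inner_sub_left, sub_nonneg]
  exact (hline.le_slope_of_hasDerivAt h0 h1 one_pos (hderiv (by simpa))).trans
    (hline.slope_le_of_hasDerivAt h0 h1 one_pos (hderiv (by simpa)))

lemma mul_norm_sub_sq_le_inner_gradient_sub {s : Set E} {σ : ℝ} {h : E → ℝ}
    (hh : StrongConvexOn s σ h) {x y a b : E} (hx : x ∈ s) (hy : y ∈ s)
    (ha : HasGradientAt h a x) (hb : HasGradientAt h b y) :
    σ * ‖x - y‖ ^ 2 ≤ ⟪a - b, x - y⟫ := by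
  have hquad : ∀ {z g : E}, HasGradientAt h g z →
      HasGradientAt (fun u => h u - σ / 2 * ‖u‖ ^ 2) (g - σ • z) z := fun {z g} hg => by
    rw [hasGradientAt_iff_hasFDerivAt] at hg ⊢
    refine (hg.sub ((hasStrictFDerivAt_norm_sq z).hasFDerivAt.const_mul (σ / 2))).congr_fderiv ?_
    ext v
    simp only [sub_apply, smul_apply, InnerProductSpace.toDual_apply_apply, coe_innerSL_apply,
      nsmul_eq_mul, Nat.cast_ofNat, smul_eq_mul, map_sub, map_smul]
    ring
  have hmono := inner_gradient_sub_nonneg (strongConvexOn_iff_convex.1 hh) hx hy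
    (hquad ha) (hquad hb)
  rw [sub_sub_sub_comm, ← smul_sub, inner_sub_left, real_inner_smul_left,
    real_inner_self_eq_norm_sq] at hmono
  linarith

lemma exists_normal_gradient_add_eq_zero {C₁ C₂ : Set E} {f h : E → ℝ} {ρ : ℝ} {x y : E}
    (hxy : (x, y) ∈ bregmanFixedPointSet C₁ C₂ f h ρ) :
    ∃ p ∈ normalCone C₁ x, ∃ q ∈ normalCone C₂ y, gradient f x + gradient f y + p + q = 0 := by
  obtain ⟨p, hp, q, hq, hx, hy⟩ := hxy
  refine ⟨p, hp, q, hq, (Eq.trans ?_ (congrArg₂ (· + ·) hx hy)).trans (add_zero 0)⟩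
  module

lemma exists_norm_gradient_le {L : E →L[ℝ] E} {g : E} {f : E → ℝ}
    (hf : ∀ x, HasGradientAt f (L x + g) x) {s : Set E} (hs : Bornology.IsBounded s) :
    ∃ M : ℝ, ∀ x ∈ s, ‖gradient f x‖ ≤ M := by
  obtain ⟨M, hM⟩ := (hs.image L).exists_norm_le
  refine ⟨M + ‖g‖, fun x hx => ?_⟩
  rw [(hf x).gradient]
  exact (norm_add_le _ _).trans (by gcongr; exact hM _ ⟨x, hx, rfl⟩)

lemma mul_inner_le_of_mem_bregmanFixedPointSet {C₁ C₂ : Set E} {f h : E → ℝ} {ρ : ℝ} {x y z : E}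
    (hxy : (x, y) ∈ bregmanFixedPointSet C₁ C₂ f h ρ) (hz : z ∈ C₁ ∩ C₂) :
    ρ * ⟪gradient h x - gradient h y, x - y⟫ ≤
      ⟪gradient f y, z - x⟫ + ⟪gradient f x, z - y⟫ := by
  obtain ⟨p, hp, q, hq, hx, hy⟩ := hxy
  set Δ := gradient h x - gradient h y with hΔ
  have hp' : p = -(gradient f y + ρ • Δ) := (neg_eq_of_add_eq_zero_right hx).symm
  have hq' : q = -(gradient f x - ρ • Δ) := by
    rw [eq_comm, neg_eq_iff_add_eq_zero, ← hy, hΔ]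
    module
  have hpz := hp.2 z hz.1
  have hqz := hq.2 z hz.2
  simp only [hp', hq', inner_neg_left, inner_add_left, inner_sub_left, real_inner_smul_left]
    at hpz hqz
  have hsplit : ⟪Δ, x - y⟫ = ⟪Δ, z - y⟫ - ⟪Δ, z - x⟫ := by
    rw [← inner_sub_right, sub_sub_sub_cancel_left]
  rw [hsplit]
  linarith

lemma norm_sub_le_of_mem_bregmanFixedPointSet {C₁ C₂ s : Set E} {f h : E → ℝ} {κ M σ ρ : ℝ}
    (hκ : 0 ≤ κ) (hregular : ∀ x ∈ C₁, ∀ y ∈ C₂, ∃ z ∈ C₁ ∩ C₂, ‖x - z‖ ≤ κ * ‖x - y‖)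
    (hσ : 0 < σ) (hρ : 0 < ρ) (hh : StrongConvexOn s σ h) {x y : E} (hx : x ∈ s) (hy : y ∈ s)
    (hhx : DifferentiableAt ℝ h x) (hhy : DifferentiableAt ℝ h y)
    (hfx : ‖gradient f x‖ ≤ M) (hfy : ‖gradient f y‖ ≤ M)
    (hxy : (x, y) ∈ bregmanFixedPointSet C₁ C₂ f h ρ) :
    ‖x - y‖ ≤ M * (2 * κ + 1) / σ / ρ := by
  have hM : 0 ≤ M := (norm_nonneg _).trans hfx
  obtain ⟨p, hp, q, hq, -⟩ := id hxy
  obtain ⟨z, hz, hxz⟩ := hregular x hp.1 y hq.1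
  have hzy : ‖z - y‖ ≤ κ * ‖x - y‖ + ‖x - y‖ :=
    (norm_sub_le_norm_sub_add_norm_sub z x y).trans (by rw [norm_sub_rev z x]; gcongr)
  have hquadratic : ρ * (σ * ‖x - y‖ ^ 2) ≤ M * (2 * κ + 1) * ‖x - y‖ :=
    calc ρ * (σ * ‖x - y‖ ^ 2)
        ≤ ρ * ⟪gradient h x - gradient h y, x - y⟫ := by
          gcongr
          exact mul_norm_sub_sq_le_inner_gradient_sub hh hx hy hhx.hasGradientAt hhy.hasGradientAt
      _ ≤ ⟪gradient f y, z - x⟫ + ⟪gradient f x, z - y⟫ :=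
          mul_inner_le_of_mem_bregmanFixedPointSet hxy hz
      _ ≤ M * (κ * ‖x - y‖) + M * (κ * ‖x - y‖ + ‖x - y‖) := by
          rw [norm_sub_rev] at hxz
          gcongr
          · exact (real_inner_le_norm _ _).trans (by gcongr)
          · exact (real_inner_le_norm _ _).trans (by gcongr)
      _ = M * (2 * κ + 1) * ‖x - y‖ := by ring
  rcases (norm_nonneg (x - y)).eq_or_lt with hzero | hpos
  · rw [← hzero]
    positivity
  · rw [div_div, le_div_iff₀ (by positivity)]
    exact le_of_mul_le_mul_right (by linarith) hpos

end Stationary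

section Polyhedral

open scoped RealInnerProductSpace

variable {E : Type*} [NormedAddCommGroup E] [InnerProductSpace ℝ E] [FiniteDimensional ℝ E]
  {C₁ C₂ : Set E} {f : E → ℝ}

lemma stationarySet_nonempty (hC₁ : IsPolyhedron C₁) (hC₂ : IsPolyhedron C₂)
    (hbounded : Bornology.IsBounded (C₁ ∩ C₂)) (hne : (C₁ ∩ C₂).Nonempty)
    (hf : Differentiable ℝ f) :
    (stationarySet C₁ C₂ f).Nonempty := by
  have hcompact := Metric.isCompact_of_isClosed_isBounded (hC₁.isClosed.inter hC₂.isClosed) hbounded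
  obtain ⟨x, hx, hmin⟩ := hcompact.exists_isMinOn hne hf.continuous.continuousOn
  exact ⟨x, mem_stationarySet_of_neg_gradient_mem_normalCone hC₁ hC₂ <|
    neg_gradient_mem_normalCone (hC₁.convex.inter hC₂.convex) hx hmin (hf x).hasGradientAt⟩

lemma exists_norm_midpoint_sub_le {L : E →L[ℝ] E} {g : E}
    (hf : ∀ x, HasGradientAt f (L x + g) x) (hC₁ : IsPolyhedron C₁) (hC₂ : IsPolyhedron C₂) :
    ∃ C : ℝ, 0 ≤ C ∧ ∀ x y, ∀ p ∈ normalCone C₁ x, ∀ q ∈ normalCone C₂ y,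
      gradient f x + gradient f y + p + q = 0 → C * ‖x - y‖ < 1 →
        ∃ z ∈ stationarySet C₁ C₂ f, ‖(1 / 2 : ℝ) • (x + y) - z‖ ≤ C * ‖x - y‖ := by
  obtain ⟨C, hC0, hC⟩ := hC₁.exists_neg_mem_normalCone_inter_norm_sub_le hC₂ L g
  refine ⟨C, hC0, fun x y p hp q hq hsum hlt => ?_⟩
  set z := (1 / 2 : ℝ) • (x + y) with hz
  have hhalf : ‖(1 / 2 : ℝ) • (x - y)‖ ≤ ‖x - y‖ := by
    rw [norm_smul_of_nonneg one_half_pos.le]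
    linarith [norm_nonneg (x - y)]
  have hKKT : L z + g + ((1 / 2 : ℝ) • p + (1 / 2 : ℝ) • q) = 0 :=
    calc L z + g + ((1 / 2 : ℝ) • p + (1 / 2 : ℝ) • q)
        = (1 / 2 : ℝ) • (gradient f x + gradient f y + p + q) := by
          rw [(hf x).gradient, (hf y).gradient, hz, map_smul, map_add]
          module
      _ = 0 := by rw [hsum, smul_zero]
  obtain ⟨u, hu, hzu⟩ := hC x y z ‖x - y‖ _ (smul_mem_normalCone one_half_pos.le hp)
    _ (smul_mem_normalCone one_half_pos.le hq) hKKT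
    (by rwa [norm_sub_rev, show x - z = (1 / 2 : ℝ) • (x - y) by rw [hz]; module])
    (by rwa [show z - y = (1 / 2 : ℝ) • (x - y) by rw [hz]; module]) hlt
  rw [← (hf u).gradient] at hu
  exact ⟨u, mem_stationarySet_of_neg_gradient_mem_normalCone hC₁ hC₂ hu, hzu⟩

lemma exists_infDist_midpoint_le {L : E →L[ℝ] E} {g : E}
    (hf : ∀ x, HasGradientAt f (L x + g) x) (hC₁ : IsPolyhedron C₁) (hC₂ : IsPolyhedron C₂)
    (hbounded₁ : Bornology.IsBounded C₁) (hbounded₂ : Bornology.IsBounded C₂)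
    (hne : (stationarySet C₁ C₂ f).Nonempty) :
    ∃ C : ℝ, 0 ≤ C ∧ ∀ x y, ∀ p ∈ normalCone C₁ x, ∀ q ∈ normalCone C₂ y,
      gradient f x + gradient f y + p + q = 0 →
        Metric.infDist ((1 / 2 : ℝ) • (x + y)) (stationarySet C₁ C₂ f) ≤ C * ‖x - y‖ := by
  obtain ⟨C, hC0, hC⟩ := exists_norm_midpoint_sub_le hf hC₁ hC₂
  obtain ⟨u, hu⟩ := hne
  obtain ⟨R, hR0, hR⟩ := (hbounded₁.union hbounded₂).exists_pos_norm_le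
  refine ⟨C * (1 + 2 * R), by positivity, fun x y p hp q hq hsum => ?_⟩
  have hnn : 0 ≤ C * ‖x - y‖ := by positivity
  rcases lt_or_ge (C * ‖x - y‖) 1 with hlt | hge
  · obtain ⟨z, hz, hdist⟩ := hC x y p hp q hq hsum hlt
    rw [← dist_eq_norm] at hdist
    refine (Metric.infDist_le_dist_of_mem hz).trans (hdist.trans ?_)
    nlinarith
  · have hmid : ‖(1 / 2 : ℝ) • (x + y)‖ ≤ R := by
      rw [norm_smul_of_nonneg one_half_pos.le]
      linarith [norm_add_le x y, hR x (.inl hp.1), hR y (.inr hq.1)]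
    calc Metric.infDist ((1 / 2 : ℝ) • (x + y)) (stationarySet C₁ C₂ f)
        ≤ ‖(1 / 2 : ℝ) • (x + y) - u‖ := by
          rw [← dist_eq_norm]
          exact Metric.infDist_le_dist_of_mem hu
      _ ≤ R + R := (norm_sub_le _ _).trans (add_le_add hmid (hR u (.inl hu.1.1)))
      _ ≤ C * (1 + 2 * R) * ‖x - y‖ := by nlinarith

end Polyhedral

section GromovWasserstein

lemma norm_le_sum_of_nonneg {α : Type*} [Fintype α] {x : EuclideanSpace ℝ α} (hx : ∀ a, 0 ≤ x a) :
    ‖x‖ ≤ ∑ a, x a := by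
  refine le_of_sq_le_sq ?_ (Finset.sum_nonneg fun a _ => hx a)
  rw [EuclideanSpace.real_norm_sq_eq]
  exact Finset.sum_sq_le_sq_sum_of_nonneg fun a _ => hx a

variable {n m : ℕ}

lemma isPolyhedron_setOf_coord_nonneg :
    IsPolyhedron {π : Coupling n m | ∀ i j, 0 ≤ π (i, j)} := by
  simp only [Set.ofPred_forall]
  exact .iInter fun i => .iInter fun j => by
    simpa using IsPolyhedron.setOf_le (-EuclideanSpace.proj (i, j) : Coupling n m →L[ℝ] ℝ) 0

lemma isPolyhedron_rowSet (μ : Fin n → ℝ) : IsPolyhedron (rowSet m μ) := by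
  have hmarginal : IsPolyhedron {π : Coupling n m | ∀ i, ∑ j, π (i, j) = μ i} := by
    simp only [Set.ofPred_forall]
    exact .iInter fun i => by
      simpa using
        IsPolyhedron.setOf_eq (∑ j, EuclideanSpace.proj (i, j) : Coupling n m →L[ℝ] ℝ) (μ i)
  exact isPolyhedron_setOf_coord_nonneg.inter hmarginal

lemma isPolyhedron_colSet (ν : Fin m → ℝ) : IsPolyhedron (colSet n ν) := by
  have hmarginal : IsPolyhedron {π : Coupling n m | ∀ j, ∑ i, π (i, j) = ν j} := by
    simp only [Set.ofPred_forall]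
    exact .iInter fun j => by
      simpa using
        IsPolyhedron.setOf_eq (∑ i, EuclideanSpace.proj (i, j) : Coupling n m →L[ℝ] ℝ) (ν j)
  exact isPolyhedron_setOf_coord_nonneg.inter hmarginal

lemma isBounded_rowSet (μ : Fin n → ℝ) : Bornology.IsBounded (rowSet m μ) := by
  refine isBounded_iff_forall_norm_le.2 ⟨∑ i, μ i, fun π hπ => ?_⟩
  calc ‖π‖ ≤ ∑ a, π a := norm_le_sum_of_nonneg fun a => hπ.1 a.1 a.2
    _ = ∑ i, μ i := by simp only [Fintype.sum_prod_type, hπ.2]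

lemma isBounded_colSet (ν : Fin m → ℝ) : Bornology.IsBounded (colSet n ν) := by
  refine isBounded_iff_forall_norm_le.2 ⟨∑ j, ν j, fun π hπ => ?_⟩
  calc ‖π‖ ≤ ∑ a, π a := norm_le_sum_of_nonneg fun a => hπ.1 a.1 a.2
    _ = ∑ j, ν j := by simp only [Fintype.sum_prod_type_right, hπ.2]

lemma rowSet_inter_colSet_nonempty {μ : Fin n → ℝ} {ν : Fin m → ℝ}
    (hμ : ∀ i, 0 ≤ μ i) (hν : ∀ j, 0 ≤ ν j) (hμ1 : ∑ i, μ i = 1) (hν1 : ∑ j, ν j = 1) :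
    (rowSet m μ ∩ colSet n ν).Nonempty := by
  refine ⟨WithLp.toLp 2 fun a => μ a.1 * ν a.2, ⟨fun i j => mul_nonneg (hμ i) (hν j), fun i => ?_⟩,
    fun i j => mul_nonneg (hμ i) (hν j), fun j => ?_⟩
  · simp only [← Finset.mul_sum, hν1, mul_one]
  · simp only [← Finset.sum_mul, hμ1, one_mul]

lemma exists_hasGradientAt_objective (DX : Matrix (Fin n) (Fin n) ℝ)
    (DY : Matrix (Fin m) (Fin m) ℝ) :
    ∃ L : Coupling n m →L[ℝ] Coupling n m, ∀ π, HasGradientAt (objective DX DY) (L π) π := by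
  have hadd : ∀ x y : Coupling n m, toMat (x + y) = toMat x + toMat y := fun _ _ => rfl
  have hsmul : ∀ (t : ℝ) (x : Coupling n m), toMat (t • x) = t • toMat x := fun _ _ => rfl
  let A : Coupling n m →L[ℝ] Coupling n m := LinearMap.toContinuousLinearMap
    { toFun := fun x => WithLp.toLp 2 fun a => -(DX * toMat x * DY) a.1 a.2
      map_add' := fun x y => by
        ext a
        simp only [hadd, Matrix.mul_add, Matrix.add_mul, Matrix.add_apply, neg_add_rev,
          PiLp.add_apply]
        ring
      map_smul' := fun t x => by
        ext a
        simp [hsmul] }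
  have hquadratic : objective DX DY = fun x => inner ℝ (A x) x := by
    funext x
    simp [objective, A, PiLp.inner_apply, Fintype.sum_prod_type, Matrix.trace, toMat,
      Matrix.mul_apply (N := Matrix.transpose _), mul_comm]
  refine ⟨A + ContinuousLinearMap.adjoint A, fun x => ?_⟩
  rw [hquadratic, hasGradientAt_iff_hasFDerivAt]
  refine (A.hasFDerivAt.inner ℝ (hasFDerivAt_id x)).congr_fderiv ?_
  ext d
  simp [ContinuousLinearMap.adjoint_inner_left, real_inner_comm]

end GromovWasserstein

end GW

open GW in
theorem mainTheorem2_general {E : Type*} [NormedAddCommGroup E] [InnerProductSpace ℝ E]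
    [FiniteDimensional ℝ E] {C₁ C₂ : Set E} (hC₁ : IsPolyhedron C₁) (hC₂ : IsPolyhedron C₂)
    (hbounded₁ : Bornology.IsBounded C₁) (hbounded₂ : Bornology.IsBounded C₂)
    (hne : (C₁ ∩ C₂).Nonempty) {f : E → ℝ} {L : E →L[ℝ] E} {g : E}
    (hf : ∀ x, HasGradientAt f (L x + g) x) {σ : ℝ} (hσ : 0 < σ) :
    (stationarySet C₁ C₂ f).Nonempty ∧
    ∃ τ₁ τ₂ : ℝ, ∀ (D : Set E) (h : E → ℝ), IsOpen D → DifferentiableOn ℝ h D →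
      StrongConvexOn (D ∩ convexHull ℝ (C₁ ∪ C₂)) σ h →
      ∀ ρ : ℝ, 0 < ρ → ∀ x y : E, x ∈ D → y ∈ D → (x, y) ∈ bregmanFixedPointSet C₁ C₂ f h ρ →
        ‖x - y‖ ≤ τ₁ / ρ ∧
        Metric.infDist ((1 / 2 : ℝ) • (x + y)) (stationarySet C₁ C₂ f) ≤ τ₂ / ρ := by
  have hstationary : (stationarySet C₁ C₂ f).Nonempty :=
    stationarySet_nonempty hC₁ hC₂ (hbounded₁.subset Set.inter_subset_left) hne
      fun x => (hf x).differentiableAt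
  obtain ⟨κ, hκ, hregular⟩ := hC₁.exists_mem_inter_norm_sub_le hC₂ hne
  obtain ⟨M, hM⟩ := exists_norm_gradient_le hf (hbounded₁.union hbounded₂)
  obtain ⟨C, hC0, hC⟩ := exists_infDist_midpoint_le hf hC₁ hC₂ hbounded₁ hbounded₂ hstationary
  refine ⟨hstationary, M * (2 * κ + 1) / σ, C * (M * (2 * κ + 1) / σ),
    fun D h hD hh hconvex ρ hρ x y hx hy hxy => ?_⟩
  obtain ⟨p, hp, q, hq, hsum⟩ := exists_normal_gradient_add_eq_zero hxy
  have hdist : ‖x - y‖ ≤ M * (2 * κ + 1) / σ / ρ :=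
    norm_sub_le_of_mem_bregmanFixedPointSet hκ hregular hσ hρ hconvex
      ⟨hx, subset_convexHull ℝ _ (.inl hp.1)⟩ ⟨hy, subset_convexHull ℝ _ (.inr hq.1)⟩
      (hh.differentiableAt (hD.mem_nhds hx)) (hh.differentiableAt (hD.mem_nhds hy))
      (hM x (.inl hp.1)) (hM y (.inr hq.1)) hxy
  refine ⟨hdist, (hC x y p hp q hq hsum).trans ?_⟩
  rw [mul_div_assoc]
  gcongr

theorem mainTheorem2 {n m : ℕ}
    (DX : Matrix (Fin n) (Fin n) ℝ) (DY : Matrix (Fin m) (Fin m) ℝ)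
    (hDX : DX.IsSymm) (hDY : DY.IsSymm)
    (μ : Fin n → ℝ) (ν : Fin m → ℝ)
    (hμ : ∀ i, 0 ≤ μ i) (hν : ∀ j, 0 ≤ ν j)
    (hμ1 : ∑ i, μ i = 1) (hν1 : ∑ j, ν j = 1)
    (σ : ℝ) (hσ : 0 < σ) :
    (GW.criticalSet DX DY μ ν).Nonempty ∧
    ∃ τ₁ τ₂ : ℝ, ∀ (D : Set (GW.Coupling n m)) (h : GW.Coupling n m → ℝ),
      IsOpen D → Convex ℝ D → DifferentiableOn ℝ h D →
      StrongConvexOn (D ∩ convexHull ℝ (GW.rowSet m μ ∪ GW.colSet n ν)) σ h →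
      ∀ ρ : ℝ, 0 < ρ → ∀ π w : GW.Coupling n m, π ∈ D → w ∈ D →
        (π, w) ∈ GW.fixedPointSet DX DY μ ν h ρ →
        ‖π - w‖ ≤ τ₁ / ρ ∧
        Metric.infDist ((1 / 2 : ℝ) • (π + w)) (GW.criticalSet DX DY μ ν) ≤ τ₂ / ρ := by
  obtain ⟨L, hL⟩ := GW.exists_hasGradientAt_objective DX DY
  obtain ⟨hcritical, τ₁, τ₂, hτ⟩ := mainTheorem2_general (GW.isPolyhedron_rowSet μ)
    (GW.isPolyhedron_colSet ν) (GW.isBounded_rowSet μ) (GW.isBounded_colSet ν)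
    (GW.rowSet_inter_colSet_nonempty hμ hν hμ1 hν1) (g := 0) (by simpa using hL) hσ
  exact ⟨hcritical, τ₁, τ₂, fun D h hD _ => hτ D h hD⟩
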